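/- Let $\mathbb{F}_q$ be a finite field, let $\nu\ge 1$, and let $K=\begin{pmatrix}0&I^{(\nu)}\\-I^{(\nu)}&0\end{pmatrix}$. An $m$-dimensional subspace $P$ of $\mathbb{F}_q^{2\nu}$ (row vectors) is said to be of type $(m,s)$ if $MK\,{}^{t}\!M$ has rank $2s$, where $M$ is any $m\times 2\nu$ matrix whose rows form a basis of $P$; $\mathcal{M}(m,s;2\nu)$ denotes the set of subspaces of type $(m,s)$. The symplectic inner product graph $Spi(2\nu,q)$ has as vertices the subspaces of $\mathbb{F}_q^{2\nu}$ other than $0$ and $\mathbb{F}_q^{2\nu}$, two (not necessarily distinct) vertices $A,B$ being adjacent if and only if $\alpha K\,{}^{t}\!\beta=0$ for all $\alpha\in A$, $\beta\in B$; in particular, there is a loop at every totally isotropic vertex. An automorphism is a permutation $\sigma$ of the vertices such that $\sigma(A)$ and $\sigma(B)$ are adjacent if and only if $A$ and $B$ are. For all integers $m,s\ge 0$ with $1\le m\le 2\nu-1$ and $2s\le m\le \nu+s$, the set $\mathcal{M}(m,s;2\nu)$ is exactly one orbit (in particular, it is non-empty) of the action of $\mathrm{Aut}(Spi(2\nu,q))$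 on the vertices of $Spi(2\nu,q)$. Moreover, two vertices lie in the same orbit of $\mathrm{Aut}(Spi(2\nu,q))$ if and only if they have the same type, that is, if and only if there are $m,s\geq 0$ such that both are of type $(m,s)$. -/

import Mathlib

/-- The row space of dimension `2ν` over `F`. The index type `Fin ν ⊕ Fin ν` lists the first `ν`
coordinates (left summand) and then the last `ν` coordinates (right summand). -/
abbrev SpVec (F : Type*) (ν : ℕ) : Type _ := Fin ν ⊕ Fin ν → F

/-- The block matrix `K = (0, I; -I, 0)` of size `2ν × 2ν`. -/
def sympK (F : Type*) [Field F] (ν : ℕ) : Matrix (Fin ν ⊕ Fin ν) (Fin ν ⊕ Fin ν) F :=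
  Matrix.fromBlocks 0 1 (-1) 0

/-- The symplectic inner product `α K βᵗ`. -/
def sympInner {F : Type*} [Field F] {ν : ℕ} (α β : SpVec F ν) : F :=
  dotProduct α (Matrix.mulVec (sympK F ν) β)

/-- `M` is a matrix representation of the subspace `P`: its rows form a basis of `P`. -/
def IsMatrixRep {F : Type*} [Field F] {ν m : ℕ} (M : Matrix (Fin m) (Fin ν ⊕ Fin ν) F)
    (P : Submodule F (SpVec F ν)) : Prop :=
  LinearIndependent F M.row ∧ Submodule.span F (Set.range M.row) = P

/-- `P` is a subspace of type `(m, s)`: it has dimension `m`, and `M K Mᵗ` has rank `2s`,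
where `M` is a matrix representation of `P` (the rank does not depend on the choice of `M`). -/
def IsOfType {F : Type*} [Field F] {ν : ℕ} (P : Submodule F (SpVec F ν)) (m s : ℕ) : Prop :=
  ∃ M : Matrix (Fin m) (Fin ν ⊕ Fin ν) F,
    IsMatrixRep M P ∧ (M * sympK F ν * M.transpose).rank = 2 * s

/-- The set of all subspaces of type `(m, s)`. -/
def subspacesOfType (F : Type*) [Field F] (ν m s : ℕ) : Set (Submodule F (SpVec F ν)) :=
  {P | IsOfType P m s}

/-- The vertices of the symplectic inner product graph: the non-trivial subspaces, i.e. those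
that are neither zero nor the whole space. -/
abbrev SpiVertex (F : Type*) [Field F] (ν : ℕ) : Type _ :=
  {P : Submodule F (SpVec F ν) // P ≠ ⊥ ∧ P ≠ ⊤}

/-- Adjacency in the symplectic inner product graph: `A K Bᵗ = 0`. The graph is undirected and
has loops: `A` is adjacent to itself exactly when it is totally isotropic. -/
def spiAdj (F : Type*) [Field F] (ν : ℕ) (A B : SpiVertex F ν) : Prop :=
  ∀ α ∈ A.1, ∀ β ∈ B.1, sympInner α β = 0

/-- The automorphism group of the symplectic inner product graph: the permutations `σ` of the
vertices such that `σ A` and `σ B` are adjacent if and only if `A` and `B` are. -/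
abbrev SpiAut (F : Type*) [Field F] (ν : ℕ) : Type _ := spiAdj F ν ≃r spiAdj F ν

/-! Put V = `SpVec F ν` and rad P = P ∩ P^⊥. The kernel of M K Mᵗ is a copy of rad P, so having type
(m, s) means dim P = m and dim rad P = m - 2s. The claim is thus that the orbits are the fibres of P
↦ (dim P, dim rad P).

Automorphisms preserve both numbers: the graph remembers inclusion, since A ≤ B iff every neighbour
of B is a neighbour of A, and it remembers A^⊥ as the largest neighbour of A. An automorphism
therefore extends to a lattice automorphism compatible with ⊥; it preserves dimensions (heights) and
radicals.

Conversely, V splits into orthogonal hyperbolic planes so that P is a product of full planes, lines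
and zeros (`exists_adapted_coordinates`). The two dimensions determine how many factors of each kind
occur, so permuting planes yields an isometry between two subspaces with the same numbers, and an
isometry induces a graph automorphism. The same coordinates show that every subspace has a type and
that all listed types occur. -/

open Module

/-! ### Symplectic coordinates adapted to a subspace -/

/-- The standard alternating form on a product of hyperbolic planes. -/
def hypForm {F ι : Type*} [Field F] [Fintype ι] (u v : ι → F × F) : F :=
  ∑ i, ((u i).1 * (v i).2 - (u i).2 * (v i).1)

/-- The three kinds of subspaces of a hyperbolic plane, up to isometry. -/
def planeSub (F : Type*) [Field F] (j : Fin 3) : Submodule F (F × F) :=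
  if j = 0 then ⊤ else if j = 1 then LinearMap.ker (LinearMap.snd F F F) else ⊥

/-- The pair is chosen by how isotropic P is: both vectors in P if the form is nonzero on P; x in P
and any dual y if P is nonzero and totally isotropic; any pair if P = 0. In the last two cases,
pairing with x and y kills the forbidden coefficients. -/
theorem exists_hyperbolic_pair {F V : Type*} [Field F] [AddCommGroup V] [Module F V]
    [Nontrivial V] (B : LinearMap.BilinForm F V) (hB : ∀ v, (∀ u, B v u = 0) → v = 0)
    (ha : B.IsAlt) (P : Submodule F V) :
    ∃ (x y : V) (j : Fin 3), B x y = 1 ∧ ∀ (a b : F) (w : V), B x w = 0 → B y w = 0 →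
      (a • x + b • y + w ∈ P ↔ (a, b) ∈ planeSub F j ∧ w ∈ P) := by
  have hdual : ∀ x : V, x ≠ 0 → ∃ y, B x y = 1 := by
    intro x hx
    obtain ⟨y, hy⟩ : ∃ y, B x y ≠ 0 := by
      by_contra! h
      exact hx (hB x h)
    exact ⟨(B x y)⁻¹ • y, by simp [hy]⟩
  by_cases h0 : ∃ x ∈ P, ∃ y ∈ P, B x y ≠ 0
  · obtain ⟨x, hx, y, hy, hxy⟩ := h0
    refine ⟨x, (B x y)⁻¹ • y, 0, by simp [hxy], fun a b w _ _ => ?_⟩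
    have h1 : a • x + b • (B x y)⁻¹ • y ∈ P :=
      P.add_mem (P.smul_mem _ hx) (P.smul_mem _ (P.smul_mem _ hy))
    rw [P.add_mem_iff_right h1]
    simp [planeSub]
  · push Not at h0
    by_cases h1 : P = ⊥
    · obtain ⟨x, hx⟩ := exists_ne (0 : V)
      obtain ⟨y, hy⟩ := hdual x hx
      refine ⟨x, y, 2, hy, fun a b w hxw hyw => ?_⟩
      have hyx : B y x = -1 := by rw [← hy, ha.neg_eq]
      subst h1
      simp only [planeSub, Submodule.mem_bot]
      simp only [Fin.reduceEq, if_false, Submodule.mem_bot, Prod.mk_eq_zero]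
      constructor
      · intro h
        have hb : b = 0 := by
          have := congrArg (B x) h
          simpa [hxw, hy, ha.self_eq_zero] using this
        have ha' : a = 0 := by
          have := congrArg (B y) h
          simpa [hyw, hyx, ha.self_eq_zero] using this
        subst hb ha'
        simpa using h
      · rintro ⟨⟨rfl, rfl⟩, rfl⟩
        simp
    · obtain ⟨x, hxP, hx⟩ := P.ne_bot_iff.1 h1
      obtain ⟨y, hy⟩ := hdual x hx
      refine ⟨x, y, 1, hy, fun a b w hxw hyw => ?_⟩
      simp only [planeSub]
      simp only [Fin.reduceEq, if_false, if_true, LinearMap.mem_ker, LinearMap.snd_apply]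
      constructor
      · intro h
        have hb : b = 0 := by
          have := h0 x hxP _ h
          simpa [hxw, hy, ha.self_eq_zero] using this
        subst hb
        rw [zero_smul, add_zero, P.add_mem_iff_right (P.smul_mem _ hxP)] at h
        exact ⟨rfl, h⟩
      · rintro ⟨rfl, hw⟩
        rw [zero_smul, add_zero]
        exact P.add_mem (P.smul_mem _ hxP) hw

/-- The splitting of a space along a hyperbolic pair. -/
theorem exists_hyperbolic_splitting {F V : Type*} [Field F] [AddCommGroup V] [Module F V]
    (B : LinearMap.BilinForm F V) (ha : B.IsAlt) {x y : V} (hxy : B x y = 1) :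
    ∃ W : Submodule F V, (∀ w, w ∈ W ↔ B x w = 0 ∧ B y w = 0) ∧
      ∃ T : ((F × F) × W) ≃ₗ[F] V, ∀ p, T p = p.1.1 • x + p.1.2 • y + (p.2 : V) := by
  have hyx : B y x = -1 := by rw [← hxy, ha.neg_eq]
  let T : ((F × F) × ↥(LinearMap.ker (B x) ⊓ LinearMap.ker (B y))) →ₗ[F] V :=
    ((LinearMap.toSpanSingleton F V x).coprod (LinearMap.toSpanSingleton F V y)).coprod
      (Submodule.subtype _)
  have hT : ∀ p, T p = p.1.1 • x + p.1.2 • y + (p.2 : V) := fun p => by simp [T]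
  refine ⟨LinearMap.ker (B x) ⊓ LinearMap.ker (B y), fun w => Iff.rfl,
    LinearEquiv.ofBijective T ⟨?_, ?_⟩, hT⟩
  · rw [injective_iff_map_eq_zero]
    rintro ⟨⟨a, b⟩, ⟨w, hw⟩⟩ h
    rw [hT] at h
    simp only [Submodule.mem_inf, LinearMap.mem_ker] at hw
    simp only at h
    have hb : b = 0 := by
      have := congrArg (B x) h
      simpa [hw.1, hxy, ha.self_eq_zero] using this
    have ha' : a = 0 := by
      have := congrArg (B y) h
      simpa [hw.2, hyx, ha.self_eq_zero] using this
    subst hb ha'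
    simp only [zero_smul, zero_add] at h
    subst h
    rfl
  · intro v
    -- Pairing v = a x + b y + w with x and y gives b = B x v and a = -B y v.
    refine ⟨⟨(-B y v, B x v), ⟨v - ((-B y v) • x + B x v • y), ?_⟩⟩, ?_⟩
    · simp [hxy, hyx, ha.self_eq_zero]
    · rw [hT]
      simp

/-- Every subspace of a nondegenerate alternating space is, in suitable symplectic coordinates,
a product of standard subspaces of hyperbolic planes. -/
theorem exists_adapted_coordinates {F : Type*} [Field F] (d : ℕ) :
    ∀ {V : Type*} [AddCommGroup V] [Module F V] [FiniteDimensional F V]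
      (B : LinearMap.BilinForm F V) (_ : ∀ v, (∀ u, B v u = 0) → v = 0) (_ : B.IsAlt)
      (P : Submodule F V) (_ : finrank F V = d),
      ∃ (n : ℕ) (k : Fin n → Fin 3) (e : V ≃ₗ[F] (Fin n → F × F)),
        (∀ u v, B u v = hypForm (e u) (e v)) ∧ ∀ v, v ∈ P ↔ ∀ i, e v i ∈ planeSub F (k i) := by
  induction d using Nat.strong_induction_on with
  | _ d ih =>
  intro V _ _ _ B hB ha P hd
  rcases subsingleton_or_nontrivial V with hV | hV
  · refine ⟨0, Fin.elim0, LinearEquiv.ofBijective 0 ⟨fun _ _ _ => Subsingleton.elim _ _,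
      fun b => ⟨0, Subsingleton.elim _ _⟩⟩, fun u v => ?_, fun v => ?_⟩
    · rw [Subsingleton.elim u 0]
      simp [hypForm]
    · rw [Subsingleton.elim v 0]
      simp
  · obtain ⟨x, y, j, hxy, hP⟩ := exists_hyperbolic_pair B hB ha P
    obtain ⟨W, hW, T, hT⟩ := exists_hyperbolic_splitting B ha hxy
    have hyx : B y x = -1 := by rw [← hxy, ha.neg_eq]
    have hWm : ∀ w : W, B x w = 0 ∧ B y w = 0 := fun w => (hW w).1 w.2
    have hWm' : ∀ w : W, B w x = 0 ∧ B w y = 0 := fun w => by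
      rw [← ha.neg_eq, ← ha.neg_eq y]; simp [hWm w]
    have hBT : ∀ p q, B (T p) (T q) =
        p.1.1 * q.1.2 - p.1.2 * q.1.1 + B p.2 q.2 := by
      intro p q
      rw [hT, hT]
      simp [hWm, hWm', hxy, hyx, ha.self_eq_zero]
      ring
    have hfr : finrank F W < d := by
      have := T.finrank_eq
      simp only [finrank_prod, finrank_self] at this
      omega
    -- Induct on the orthogonal complement W of the plane; a vector of W orthogonal to W is
    -- orthogonal to everything, so the restricted form stays nondegenerate.
    obtain ⟨n, k, e, he, hk⟩ := ih _ hfr (B.restrict W) (fun w hw => by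
        have : (w : V) = 0 := hB _ fun u => by
          obtain ⟨q, rfl⟩ := T.surjective u
          have h1 : (w : V) = T (0, w) := by simp [hT]
          have h2 := hw q.2
          rw [LinearMap.BilinForm.restrict_apply] at h2
          rw [h1, hBT]
          simpa using h2
        exact Subtype.ext this) (fun w => ha w) (P.comap W.subtype) rfl
    refine ⟨n + 1, Fin.cons j k, T.symm ≪≫ₗ ((LinearEquiv.refl F (F × F)).prodCongr e) ≪≫ₗ
      Fin.consLinearEquiv F (fun _ => F × F), ?_, ?_⟩
    · intro u v
      obtain ⟨p, rfl⟩ := T.surjective u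
      obtain ⟨q, rfl⟩ := T.surjective v
      rw [hBT]
      have := he p.2 q.2
      rw [LinearMap.BilinForm.restrict_apply] at this
      simp only [LinearMap.domRestrict_apply] at this
      rw [this]
      simp only [hypForm, Fin.sum_univ_succ]
      simp
    · intro v
      obtain ⟨p, rfl⟩ := T.surjective v
      rw [hT, hP _ _ _ (hWm _).1 (hWm _).2]
      have := hk p.2
      simp only [Submodule.mem_comap, Submodule.subtype_apply] at this
      rw [this, Fin.forall_fin_succ]
      simp [← hT]

/-! ### Orthogonals and dimensions in adapted coordinates -/

/-- Orthogonality is tested plane by plane: the full plane and zero are each other's complements and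
the line is its own, so `Fin.rev` encodes the complement. -/
theorem hypForm_orthogonal_iff {F ι : Type*} [Field F] [Fintype ι] (k : ι → Fin 3)
    (u : ι → F × F) :
    (∀ v : ι → F × F, (∀ i, v i ∈ planeSub F (k i)) → hypForm v u = 0) ↔
      ∀ i, u i ∈ planeSub F (k i).rev := by
  classical
  have key : ∀ (j : Fin 3) (c : F × F), (∀ d ∈ planeSub F j, d.1 * c.2 - d.2 * c.1 = 0) ↔
      c ∈ planeSub F j.rev := by
    intro j c
    fin_cases j
    · simp only [planeSub, Fin.rev]
      simp only [Fin.zero_eta, if_true, Submodule.mem_top, true_imp_iff]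
      simp only [Fin.ext_iff]
      norm_num
      constructor
      · intro h
        exact Prod.ext (by simpa using h 0 1) (by simpa using h 1 0)
      · rintro rfl
        simp
    · simp only [planeSub, Fin.rev]
      simp only [Fin.ext_iff]
      norm_num
      exact ⟨fun h => by simpa using h 1, fun h => by simp [h]⟩
    · simp [planeSub, Fin.rev]
  constructor
  · intro h i
    rw [← key]
    intro d hd
    have := h (Pi.single i d) fun i' => by
      by_cases hi : i' = i
      · subst hi
        simpa using hd
      · simp [hi]
    unfold hypForm at this
    rw [Finset.sum_eq_single i (fun b _ hb => by simp [hb]) (by simp)] at this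
    simpa using this
  · intro h v hv
    exact Finset.sum_eq_zero fun i _ => (key _ _).2 (h i) _ (hv i)

theorem finrank_pi_submodule {F ι M : Type*} [Field F] [Fintype ι] [AddCommGroup M] [Module F M]
    [FiniteDimensional F M] (L : ι → Submodule F M) :
    finrank F (Submodule.pi Set.univ L) = ∑ i, finrank F (L i) := by
  rw [← finrank_pi_fintype]
  exact LinearEquiv.finrank_eq
    { toFun := fun v i => ⟨v.1 i, v.2 i (Set.mem_univ i)⟩
      invFun := fun v => ⟨fun i => v i, fun i _ => (v i).2⟩
      map_add' := fun _ _ => rfl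
      map_smul' := fun _ _ => rfl
      left_inv := fun _ => rfl
      right_inv := fun _ => rfl }

theorem finrank_planeSub (F : Type*) [Field F] (j : Fin 3) :
    finrank F (planeSub F j) = 2 - j := by
  have h1 : finrank F (planeSub F 1) = 1 := by
    have h := (LinearMap.snd F F F).finrank_range_add_finrank_ker
    rw [LinearMap.range_eq_top.2 Prod.snd_surjective, finrank_top] at h
    simp at h
    have : planeSub F 1 = LinearMap.ker (LinearMap.snd F F F) := rfl
    rw [this]
    omega
  fin_cases j
  · change finrank F (⊤ : Submodule F (F × F)) = 2
    simp
  · exact h1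
  · change finrank F (⊥ : Submodule F (F × F)) = 0
    simp

theorem planeSub_inf_rev (F : Type*) [Field F] (j : Fin 3) :
    planeSub F j ⊓ planeSub F j.rev = planeSub F (if j = 1 then 1 else 2) := by
  fin_cases j
  · change ⊤ ⊓ (⊥ : Submodule F (F × F)) = ⊥
    simp
  · exact inf_idem _
  · change (⊥ : Submodule F (F × F)) ⊓ ⊤ = ⊥
    simp

section Coordinates

variable {F ι V : Type*} [Field F] [Fintype ι] [AddCommGroup V] [Module F V]
  {B : LinearMap.BilinForm F V} {P : Submodule F V} {k : ι → Fin 3} {e : V ≃ₗ[F] (ι → F × F)}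

theorem finrank_of_coordinates (hk : ∀ v, v ∈ P ↔ ∀ i, e v i ∈ planeSub F (k i)) :
    finrank F P = ∑ i, (2 - (k i : ℕ)) := by
  have : P = (Submodule.pi Set.univ fun i => planeSub F (k i)).comap (e : V →ₗ[F] (ι → F × F)) := by
    ext v
    simp [hk]
  rw [this, Submodule.comap_equiv_eq_map_symm, LinearEquiv.finrank_map_eq,
    finrank_pi_submodule]
  simp [finrank_planeSub]

/-- Only the self-orthogonal lines meet their complement in the plane, and each contributes
dimension one. -/
theorem finrank_radical_of_coordinates (he : ∀ u v, B u v = hypForm (e u) (e v))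
    (hk : ∀ v, v ∈ P ↔ ∀ i, e v i ∈ planeSub F (k i)) :
    finrank F ↥(P ⊓ B.orthogonal P) = Fintype.card {i // k i = 1} := by
  have : ∀ v, v ∈ P ⊓ B.orthogonal P ↔ ∀ i, e v i ∈ planeSub F (if k i = 1 then 1 else 2) := by
    intro v
    simp only [← planeSub_inf_rev, Submodule.mem_inf, forall_and, ← hk,
      ← hypForm_orthogonal_iff]
    refine and_congr_right fun _ => ⟨fun h w hw => ?_, fun h w hw => ?_⟩
    · have := h (e.symm w) ((hk _).2 (by simpa using hw))
      simpa [he] using this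
    · rw [he]
      exact h _ ((hk w).1 hw)
  rw [finrank_of_coordinates this, Fintype.card_subtype, Finset.card_filter]
  refine Finset.sum_congr rfl fun i _ => ?_
  split_ifs <;> rfl

/-- A full plane adds 2 to dim P and nothing to the radical; a line adds 1 to both. -/
theorem finrank_add_radical_of_coordinates (he : ∀ u v, B u v = hypForm (e u) (e v))
    (hk : ∀ v, v ∈ P ↔ ∀ i, e v i ∈ planeSub F (k i)) :
    finrank F P = 2 * Fintype.card {i // k i = 0} + finrank F ↥(P ⊓ B.orthogonal P) := by
  rw [finrank_radical_of_coordinates he hk, finrank_of_coordinates hk, Fintype.card_subtype,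
    Fintype.card_subtype, Finset.card_filter, Finset.card_filter, Finset.mul_sum,
    ← Finset.sum_add_distrib]
  refine Finset.sum_congr rfl fun i _ => ?_
  generalize k i = j
  fin_cases j <;> rfl

end Coordinates

/-! ### Witt's theorem for subspaces -/

theorem exists_perm_of_card_fiber_eq {ι : Type*} [Fintype ι] (k k' : ι → Fin 3)
    (h0 : Fintype.card {i // k i = 0} = Fintype.card {i // k' i = 0})
    (h1 : Fintype.card {i // k i = 1} = Fintype.card {i // k' i = 1}) :
    ∃ σ : Equiv.Perm ι, ∀ i, k' (σ i) = k i := by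
  have tot : ∀ k : ι → Fin 3, Fintype.card ι = Fintype.card {i // k i = 0} +
      Fintype.card {i // k i = 1} + Fintype.card {i // k i = 2} := by
    intro k
    rw [← Fintype.card_congr (Equiv.sigmaFiberEquiv k), Fintype.card_sigma, Fin.sum_univ_three]
  have h2 := tot k
  rw [tot k'] at h2
  have hcard : ∀ j, Fintype.card {i // k i = j} = Fintype.card {i // k' i = j} := by
    intro j
    fin_cases j
    · exact h0
    · exact h1
    · change Fintype.card {i // k i = 2} = Fintype.card {i // k' i = 2}
      omega
  exact ⟨Equiv.ofFiberEquiv fun j => Fintype.equivOfCardEq (hcard j),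
    fun i => Equiv.ofFiberEquiv_map _ i⟩

/-- Witt's theorem for subspaces: two subspaces of a nondegenerate alternating space with the
same dimension and the same dimension of the radical are conjugate under an isometry. -/
theorem exists_isometry_map_eq {F V : Type*} [Field F] [AddCommGroup V] [Module F V]
    [FiniteDimensional F V] (B : LinearMap.BilinForm F V)
    (hB : ∀ v, (∀ u, B v u = 0) → v = 0) (ha : B.IsAlt) (P Q : Submodule F V)
    (h : finrank F P = finrank F Q)
    (hr : finrank F ↥(P ⊓ B.orthogonal P) = finrank F ↥(Q ⊓ B.orthogonal Q)) :
    ∃ g : V ≃ₗ[F] V, (∀ u v, B (g u) (g v) = B u v) ∧ ∀ v, g v ∈ Q ↔ v ∈ P := by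
  obtain ⟨n, k, e, he, hk⟩ := exists_adapted_coordinates _ B hB ha P rfl
  obtain ⟨n', k', e', he', hk'⟩ := exists_adapted_coordinates _ B hB ha Q rfl
  obtain rfl : n = n' := by
    have h1 := (e.symm ≪≫ₗ e').finrank_eq
    rw [finrank_pi_fintype, finrank_pi_fintype] at h1
    simpa using h1
  have h1 := finrank_radical_of_coordinates he hk
  have h1' := finrank_radical_of_coordinates he' hk'
  have h0 := finrank_add_radical_of_coordinates he hk
  have h0' := finrank_add_radical_of_coordinates he' hk'
  obtain ⟨σ, hσ⟩ := exists_perm_of_card_fiber_eq k k' (by omega) (by omega)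
  -- Pass to coordinates adapted to P, permute the hyperbolic planes, and return through coordinates
  -- adapted to Q.
  let g := e ≪≫ₗ LinearEquiv.funCongrLeft F (F × F) σ.symm ≪≫ₗ e'.symm
  have hg : ∀ v i, e' (g v) (σ i) = e v i := fun v i => by
    simp [g, LinearEquiv.funCongrLeft_apply, LinearMap.funLeft_apply]
  refine ⟨g, fun u v => ?_, fun v => ?_⟩
  · rw [he u, he', hypForm, ← Equiv.sum_comp σ]
    simp only [hg, hypForm]
  · rw [hk, hk', ← σ.forall_congr_right]
    simp only [hg, hσ]

/-! ### Types of subspaces of the symplectic space -/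

/-- The symplectic inner product as a bilinear form. -/
def spForm (F : Type*) [Field F] (ν : ℕ) : LinearMap.BilinForm F (SpVec F ν) :=
  Matrix.toBilin' (sympK F ν)

/-- The radical of a subspace of the symplectic space. -/
def spRadical {F : Type*} [Field F] {ν : ℕ} (P : Submodule F (SpVec F ν)) :
    Submodule F (SpVec F ν) :=
  P ⊓ (spForm F ν).orthogonal P

/-- The identification of the row space with a product of hyperbolic planes. -/
def spCoordinates (F : Type*) [Field F] (ν : ℕ) : SpVec F ν ≃ₗ[F] (Fin ν → F × F) where
  toFun v i := (v (Sum.inl i), v (Sum.inr i))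
  invFun w := Sum.elim (fun i => (w i).1) (fun i => (w i).2)
  map_add' _ _ := rfl
  map_smul' _ _ := rfl
  left_inv v := by ext (i | i) <;> rfl
  right_inv _ := rfl

section Symplectic

variable {F : Type*} [Field F] {ν : ℕ}

theorem spForm_apply (u v : SpVec F ν) : spForm F ν u v = sympInner u v :=
  Matrix.toBilin'_apply' _ _ _

theorem spForm_eq_hypForm (u v : SpVec F ν) :
    spForm F ν u v = hypForm (spCoordinates F ν u) (spCoordinates F ν v) := by
  rw [hypForm, Finset.sum_sub_distrib, sub_eq_add_neg]
  simp [spForm_apply, sympInner, sympK, Matrix.fromBlocks_mulVec, dotProduct, Matrix.neg_mulVec,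
    Function.comp_def]
  rfl

theorem spForm_isAlt : (spForm F ν).IsAlt := fun v => by
  rw [spForm_eq_hypForm, hypForm]
  exact Finset.sum_eq_zero fun i _ => by ring

theorem spForm_separating (v : SpVec F ν) (h : ∀ u, spForm F ν v u = 0) : v = 0 := by
  apply (spCoordinates F ν).injective
  ext1 i
  -- With every factor a full plane, the complement is zero in each plane.
  have h1 := (hypForm_orthogonal_iff (F := F) (fun _ : Fin ν => 0) (spCoordinates F ν v)).1
    (fun w _ => by
      have := h ((spCoordinates F ν).symm w)
      rw [← spForm_isAlt.neg_eq, neg_eq_zero, spForm_eq_hypForm] at this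
      simpa using this) i
  simpa [planeSub] using h1

theorem spForm_nondegenerate : (spForm F ν).Nondegenerate :=
  ⟨spForm_separating, fun v h => spForm_separating v fun u => by
    rw [← spForm_isAlt.neg_eq, h, neg_zero]⟩

theorem spForm_orthogonal_orthogonal (P : Submodule F (SpVec F ν)) :
    (spForm F ν).orthogonal ((spForm F ν).orthogonal P) = P :=
  LinearMap.BilinForm.orthogonal_orthogonal spForm_nondegenerate spForm_isAlt.isRefl P

theorem IsMatrixRep.finrank_eq {m : ℕ} {M : Matrix (Fin m) (Fin ν ⊕ Fin ν) F}
    {P : Submodule F (SpVec F ν)} (h : IsMatrixRep M P) : finrank F P = m := by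
  rw [← h.2, finrank_span_eq_card h.1, Fintype.card_fin]

/-- The map c ↦ Mᵗ c is injective with image P and carries the kernel of M K Mᵗ onto the radical;
then apply rank-nullity. -/
theorem IsMatrixRep.rank_add_finrank_radical {m : ℕ} {M : Matrix (Fin m) (Fin ν ⊕ Fin ν) F}
    {P : Submodule F (SpVec F ν)} (h : IsMatrixRep M P) :
    (M * sympK F ν * M.transpose).rank + finrank F (spRadical P) = m := by
  have hinj : Function.Injective M.transpose.mulVecLin := by
    rw [Matrix.coe_mulVecLin, Matrix.mulVec_injective_iff]
    exact h.1
  have hrange : LinearMap.range M.transpose.mulVecLin = P := by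
    rw [Matrix.range_mulVecLin, ← h.2]
    rfl
  have hmap : (LinearMap.ker (M * sympK F ν * M.transpose).mulVecLin).map
      M.transpose.mulVecLin = spRadical P := by
    have hker : ∀ c, (M * sympK F ν * M.transpose).mulVecLin c = 0 ↔
        M.transpose.mulVecLin c ∈ (spForm F ν).orthogonal P := by
      intro c
      rw [LinearMap.BilinForm.mem_orthogonal_iff, Matrix.mulVecLin_apply,
        ← Matrix.mulVec_mulVec, ← Matrix.mulVec_mulVec]
      constructor
      · intro hc n hn
        rw [← hrange] at hn
        obtain ⟨d, rfl⟩ := hn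
        change spForm F ν _ _ = 0
        rw [spForm_apply, sympInner, Matrix.mulVecLin_apply, Matrix.mulVecLin_apply,
          Matrix.mulVec_transpose M d, ← Matrix.dotProduct_mulVec, hc, dotProduct_zero]
      · intro hc
        ext i
        have := hc (M.row i) (h.2 ▸ Submodule.subset_span ⟨i, rfl⟩)
        change spForm F ν _ _ = 0 at this
        rw [spForm_apply] at this
        exact this
    ext v
    simp only [Submodule.mem_map, LinearMap.mem_ker, hker]
    constructor
    · rintro ⟨c, hc, rfl⟩
      exact ⟨hrange ▸ LinearMap.mem_range_self _ c, hc⟩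
    · rintro ⟨hv, hv'⟩
      rw [SetLike.mem_coe, ← hrange] at hv
      obtain ⟨c, rfl⟩ := hv
      exact ⟨c, hv', rfl⟩
  have hfin : finrank F (spRadical P) =
      finrank F (LinearMap.ker (M * sympK F ν * M.transpose).mulVecLin) := by
    rw [← hmap]
    exact (Submodule.equivMapOfInjective _ hinj _).finrank_eq.symm
  rw [hfin, Matrix.rank, LinearMap.finrank_range_add_finrank_ker]
  simp

theorem isOfType_iff {P : Submodule F (SpVec F ν)} {m s : ℕ} :
    IsOfType P m s ↔ finrank F P = m ∧ 2 * s + finrank F (spRadical P) = m := by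
  constructor
  · rintro ⟨M, hM, hs⟩
    exact ⟨hM.finrank_eq, hs ▸ hM.rank_add_finrank_radical⟩
  · rintro ⟨rfl, hs⟩
    let b := finBasis F P
    have hM : IsMatrixRep (fun i => (b i : SpVec F ν) : Matrix _ _ F) P := by
      constructor
      · exact b.linearIndependent.map' P.subtype P.ker_subtype
      · have := congrArg (Submodule.map P.subtype) b.span_eq
        rw [Submodule.map_span, ← Set.range_comp, Submodule.map_subtype_top] at this
        exact this
    refine ⟨_, hM, ?_⟩
    have := hM.rank_add_finrank_radical
    omega

theorem exists_isOfType (P : Submodule F (SpVec F ν)) : ∃ m s, IsOfType P m s := by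
  obtain ⟨n, k, e, he, hk⟩ :=
    exists_adapted_coordinates _ (spForm F ν) spForm_separating spForm_isAlt P rfl
  exact ⟨_, _, isOfType_iff.2 ⟨rfl, (finrank_add_radical_of_coordinates he hk).symm⟩⟩

theorem exists_subspace_isOfType {m s : ℕ} (h1 : 2 * s ≤ m) (h2 : m ≤ ν + s) :
    ∃ P : Submodule F (SpVec F ν), IsOfType P m s := by
  -- Take s full planes, m - 2s lines and zero elsewhere. This uses m - s planes, which fit because
  -- m ≤ ν + s.
  let k : Fin ν → Fin 3 := fun i => if i < s then 0 else if i < m - s then 1 else 2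
  let P : Submodule F (SpVec F ν) :=
    (Submodule.pi Set.univ fun i => planeSub F (k i)).comap
      (spCoordinates F ν : SpVec F ν →ₗ[F] (Fin ν → F × F))
  have hk : ∀ v, v ∈ P ↔ ∀ i, spCoordinates F ν v i ∈ planeSub F (k i) := fun v => by simp [P]
  have hs : Fintype.card {i // k i = 0} = s := by
    have : ∀ i, k i = 0 ↔ (i : ℕ) < s := fun i => by
      simp only [k]
      split_ifs <;> simp_all
    simp only [this]
    rw [Fintype.card_subtype, Fin.card_filter_val_lt]
    omega
  have hr : Fintype.card {i // k i = 0} + Fintype.card {i // k i = 1} = m - s := by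
    have : ∀ i, (k i = 0 ∨ k i = 1) ↔ (i : ℕ) < m - s := fun i => by
      simp only [k]
      split_ifs with h h'
      · simp
        omega
      · simp [h']
      · simp [h']
    rw [← Fintype.card_subtype_or_disjoint]
    · simp only [this]
      rw [Fintype.card_subtype, Fin.card_filter_val_lt]
      omega
    · rw [Pi.disjoint_iff]
      intro i
      rw [Prop.disjoint_iff]
      by_contra! h
      exact absurd (h.1.symm.trans h.2) (by decide)
  have hd := finrank_add_radical_of_coordinates spForm_eq_hypForm hk
  have hd' := finrank_radical_of_coordinates spForm_eq_hypForm hk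
  refine ⟨P, isOfType_iff.2 ?_⟩
  rw [spRadical]
  omega

end Symplectic

/-! ### Automorphisms of the subspace lattice -/

/-- An order automorphism of the elements other than `⊥` and `⊤` extends to the whole order. -/
theorem exists_orderIso_extension {α : Type*} [PartialOrder α] [BoundedOrder α]
    (f : {a : α // a ≠ ⊥ ∧ a ≠ ⊤} ≃o {a : α // a ≠ ⊥ ∧ a ≠ ⊤}) :
    ∃ g : α ≃o α, ∀ a : {a : α // a ≠ ⊥ ∧ a ≠ ⊤}, g a = f a := by
  classical
  let g := Equiv.Perm.ofSubtype f.toEquiv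
  have hg : ∀ a : {a : α // a ≠ ⊥ ∧ a ≠ ⊤}, g a = f a := fun a =>
    Equiv.Perm.ofSubtype_apply_coe _ a
  have hbot : g ⊥ = ⊥ := Equiv.Perm.ofSubtype_apply_of_not_mem _ (by simp)
  have htop : g ⊤ = ⊤ := Equiv.Perm.ofSubtype_apply_of_not_mem _ (by simp)
  refine ⟨⟨g, fun {a b} => ?_⟩, hg⟩
  rcases eq_or_ne a ⊥ with rfl | ha
  · simp [hbot]
  rcases eq_or_ne b ⊤ with rfl | hb
  · simp [htop]
  rcases eq_or_ne a ⊤ with rfl | ha'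
  · rw [htop, top_le_iff, top_le_iff, ← htop, g.apply_eq_iff_eq, htop]
  rcases eq_or_ne b ⊥ with rfl | hb'
  · rw [hbot, le_bot_iff, le_bot_iff, ← hbot, g.apply_eq_iff_eq, hbot]
  have h1 := hg ⟨a, ha, ha'⟩
  have h2 := hg ⟨b, hb', hb⟩
  simp only at h1 h2
  rw [h1, h2, Subtype.coe_le_coe, f.le_iff_le]
  rfl

/-- Dimension is the height of P in the lattice of subspaces, an order invariant. -/
theorem finrank_orderIso_apply {F V : Type*} [Field F] [AddCommGroup V] [Module F V]
    [FiniteDimensional F V] (g : Submodule F V ≃o Submodule F V) (P : Submodule F V) :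
    finrank F (g P) = finrank F P := by
  have h := Order.height_orderIso g P
  rw [← Module.length_submodule, ← Module.length_submodule, Module.length_eq_finrank,
    Module.length_eq_finrank] at h
  exact_mod_cast h

/-! ### Graph automorphisms and their orbits -/

section Graph

variable {F : Type*} [Field F] {ν : ℕ}

theorem spiAdj_comm {A B : SpiVertex F ν} : spiAdj F ν A B ↔ spiAdj F ν B A := by
  have : ∀ A B : SpiVertex F ν, spiAdj F ν A B → spiAdj F ν B A := fun A B h α hα β hβ => by
    rw [← spForm_apply, ← spForm_isAlt.neg_eq, spForm_apply, h β hβ α hα, neg_zero]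
  exact ⟨this A B, this B A⟩

theorem spiAdj_iff_le_orthogonal {A B : SpiVertex F ν} :
    spiAdj F ν A B ↔ A.1 ≤ (spForm F ν).orthogonal B.1 := by
  rw [spiAdj_comm]
  refine ⟨fun h α hα β hβ => ?_, fun h β hβ α hα => ?_⟩
  · exact (spForm_apply β α).trans (h β hβ α hα)
  · exact (spForm_apply β α).symm.trans (h hα β hβ)

/-- The orthogonal complement of a vertex. -/
def SpiVertex.perp (A : SpiVertex F ν) : SpiVertex F ν :=
  ⟨(spForm F ν).orthogonal A.1, by
    constructor <;> intro h <;> have h' := spForm_orthogonal_orthogonal A.1 <;> rw [h] at h'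
    · exact A.2.2 (h' ▸ by ext; simp)
    · refine A.2.1 (h' ▸ ?_)
      rw [eq_bot_iff]
      intro v hv
      refine spForm_nondegenerate.2 v fun u => hv u trivial⟩

/-- B^⊥ is a neighbour of B; if it is also one of A, then A ≤ B^⊥⊥ = B. -/
theorem SpiVertex.le_iff_forall_spiAdj {A B : SpiVertex F ν} :
    A ≤ B ↔ ∀ C, spiAdj F ν C B → spiAdj F ν C A := by
  refine ⟨fun h C hC α hα β hβ => hC α hα β (h hβ), fun h => ?_⟩
  have h1 := h B.perp (spiAdj_iff_le_orthogonal.2 le_rfl)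
  rw [spiAdj_comm, spiAdj_iff_le_orthogonal] at h1
  exact h1.trans_eq (spForm_orthogonal_orthogonal B.1)

/-- The order automorphism induced by a graph automorphism. -/
def SpiAut.orderIso (σ : SpiAut F ν) : SpiVertex F ν ≃o SpiVertex F ν where
  toEquiv := σ.toEquiv
  map_rel_iff' {A B} := by
    rw [SpiVertex.le_iff_forall_spiAdj, SpiVertex.le_iff_forall_spiAdj,
      ← σ.toEquiv.forall_congr_right]
    exact forall_congr' fun C => imp_congr σ.map_rel_iff σ.map_rel_iff

/-- A^⊥ is characterised by C ≤ A^⊥ iff C is adjacent to A, and both relations are preserved. -/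
theorem SpiAut.perp_apply (σ : SpiAut F ν) (A : SpiVertex F ν) : σ A.perp = (σ A).perp := by
  refine eq_of_forall_le_iff fun D => ?_
  obtain ⟨C, rfl⟩ := σ.surjective D
  have h1 : ∀ C A : SpiVertex F ν, C ≤ A.perp ↔ spiAdj F ν C A := fun C A =>
    spiAdj_iff_le_orthogonal.symm
  rw [h1, σ.map_rel_iff, ← h1]
  exact (SpiAut.orderIso σ).le_iff_le

theorem SpiAut.finrank_apply (σ : SpiAut F ν) (A : SpiVertex F ν) :
    finrank F (σ A).1 = finrank F A.1 ∧
      finrank F (spRadical (σ A).1) = finrank F (spRadical A.1) := by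
  -- The radical may be zero, hence not a vertex, so the order automorphism is extended to all
  -- subspaces before taking A ⊓ A^⊥.
  obtain ⟨g, hg⟩ := exists_orderIso_extension (SpiAut.orderIso σ)
  have hg' : ∀ A : SpiVertex F ν, g A.1 = (σ A).1 := hg
  refine ⟨hg' A ▸ finrank_orderIso_apply g A.1, ?_⟩
  have : spRadical (σ A).1 = g (spRadical A.1) := by
    change (σ A).1 ⊓ (σ A).perp.1 = g (A.1 ⊓ A.perp.1)
    rw [map_inf, hg', hg', SpiAut.perp_apply]
  rw [this, finrank_orderIso_apply]

/-- The graph automorphism induced by an isometry. -/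
def SpiAut.ofIsometry (g : SpVec F ν ≃ₗ[F] SpVec F ν)
    (hg : ∀ u v, spForm F ν (g u) (g v) = spForm F ν u v) : SpiAut F ν where
  toEquiv := (Submodule.orderIsoMapComap g).toEquiv.subtypeEquiv fun P => by
    simp
  map_rel_iff' {A B} := by
    simp only [spiAdj, Equiv.subtypeEquiv_apply, RelIso.coe_fn_toEquiv,
      Submodule.orderIsoMapComap_apply, ← spForm_apply]
    constructor
    · intro h α hα β hβ
      rw [← hg]
      exact h _ (Submodule.mem_map_of_mem hα) _ (Submodule.mem_map_of_mem hβ)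
    · rintro h _ ⟨α, hα, rfl⟩ _ ⟨β, hβ, rfl⟩
      exact (hg _ _).trans (h _ hα _ hβ)

theorem mem_orbit_iff_finrank_eq {A B : SpiVertex F ν} :
    A ∈ MulAction.orbit (SpiAut F ν) B ↔ finrank F A.1 = finrank F B.1 ∧
      finrank F (spRadical A.1) = finrank F (spRadical B.1) := by
  constructor
  · rintro ⟨σ, rfl⟩
    exact SpiAut.finrank_apply σ B
  · rintro ⟨h, hr⟩
    obtain ⟨g, hg, hgP⟩ := exists_isometry_map_eq (spForm F ν) spForm_separating spForm_isAlt
      B.1 A.1 h.symm hr.symm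
    refine ⟨SpiAut.ofIsometry g hg, Subtype.ext ?_⟩
    change Submodule.map (g : SpVec F ν →ₗ[F] SpVec F ν) B.1 = A.1
    ext v
    obtain ⟨u, rfl⟩ := g.surjective v
    rw [hgP]
    refine ⟨?_, fun hu => Submodule.mem_map_of_mem hu⟩
    rintro ⟨w, hw, hwu⟩
    exact g.injective hwu ▸ hw

theorem mem_orbit_iff_isOfType {A B : SpiVertex F ν} {m s : ℕ} (hB : IsOfType B.1 m s) :
    A ∈ MulAction.orbit (SpiAut F ν) B ↔ IsOfType A.1 m s := by
  rw [mem_orbit_iff_finrank_eq]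
  rw [isOfType_iff] at hB ⊢
  omega

theorem IsOfType.ne_bot_and_ne_top {P : Submodule F (SpVec F ν)} {m s : ℕ} (h : IsOfType P m s)
    (h1 : 1 ≤ m) (h2 : m < 2 * ν) : P ≠ ⊥ ∧ P ≠ ⊤ := by
  have hm := (isOfType_iff.1 h).1
  constructor <;> rintro rfl
  · rw [finrank_bot] at hm
    omega
  · rw [finrank_top, finrank_fintype_fun_eq_card] at hm
    simp at hm
    omega

end Graph

theorem theorem3 (F : Type*) [Field F] [Finite F] (ν : ℕ) :
    (∀ m s : ℕ, 1 ≤ m → m < 2 * ν → 2 * s ≤ m → m ≤ ν + s →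
      ∃ A : SpiVertex F ν,
        subspacesOfType F ν m s = Subtype.val '' MulAction.orbit (SpiAut F ν) A) ∧
    (∀ A B : SpiVertex F ν,
      A ∈ MulAction.orbit (SpiAut F ν) B ↔
        ∃ m s : ℕ, IsOfType A.1 m s ∧ IsOfType B.1 m s) := by
  refine ⟨fun m s h1 h2 h3 h4 => ?_, fun A B => ⟨fun h => ?_, ?_⟩⟩
  · obtain ⟨P, hP⟩ := exists_subspace_isOfType (F := F) h3 h4
    refine ⟨⟨P, hP.ne_bot_and_ne_top h1 h2⟩, Set.ext fun Q => ⟨fun hQ => ?_, ?_⟩⟩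
    · exact ⟨⟨Q, hQ.ne_bot_and_ne_top h1 h2⟩, (mem_orbit_iff_isOfType hP).2 hQ, rfl⟩
    · rintro ⟨A, hA, rfl⟩
      exact (mem_orbit_iff_isOfType hP).1 hA
  · obtain ⟨m, s, hB⟩ := exists_isOfType B.1
    exact ⟨m, s, (mem_orbit_iff_isOfType hB).1 h, hB⟩
  · rintro ⟨m, s, hA, hB⟩
    exact (mem_orbit_iff_isOfType hB).2 hA
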